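/- Let $\mathbb K\in\{\mathbb R,\mathbb C\}$; all spaces are Banach spaces over $\mathbb K$, $\mathfrak L(X,Y)$ is the space of bounded linear operators, $X'$ is the dual of $X$, and $j_X:X\to X''$ is the canonical embedding. For a finite-dimensional subspace $E\subseteq X$ and a closed finite-codimensional subspace $K\subseteq Y$ write $J_E^X:E\to X$ and $Q_K^Y:Y\to Y/K$ for the inclusion and the quotient map. A Banach ideal $(\mathfrak A,\mathbf A)$ assigns to all Banach spaces $X,Y$ a linear subspace $\mathfrak A(X,Y)\subseteq\mathfrak L(X,Y)$ that is complete under a norm $\mathbf A$, such that $RTS\in\mathfrak A$ and $\mathbf A(RTS)\le\|R\|\,\mathbf A(T)\,\|S\|$ whenever $T\in\mathfrak A$ and $R,S$ are composable bounded operators, and such that every rank-one operator $x'\otimes y: x\mapsto x'(x)\,y$ (with $x'\in X'$, $y\in Y$) lies in $\mathfrak A(X,Y)$ with $\mathbf A(x'\otimes y)=\|x'\|\,\|y\|$. * $\mathfrak A$ is right-accessible if for all Banach spaces $E,Y$ with $\dim E<\infty$, all $T\in\mathfrak L(E,Y)$ and all $\varepsilon>0$ there are a finite-dimensional subspace $F\subseteq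 Y$ and $S\in\mathfrak L(E,F)$ with $T=J_F^YS$ and $\mathbf A(S)\le(1+\varepsilon)\mathbf A(T)$. * For an ultrafilter $\mathcal U$ on a set $I$, the ultraproduct $(\prod_{i\in I} X_i)_{\mathcal U}$ is the quotient of $\ell_\infty(X_i;I)$ by $\{(x_i):\lim_{\mathcal U}\|x_i\|=0\}$, and for a uniformly bounded family of operators $T_i\in\mathfrak L(X_i,Y_i)$ the operator $(T_i)_{\mathcal U}$ is given by $(x_i)_{\mathcal U}\mapsto(T_ix_i)_{\mathcal U}$. $\mathfrak A$ is ultrastable if for every ultrafilter $\mathcal U$ on every set $I$ and every family $T_i\in\mathfrak A(X_i,Y_i)$ with $\sup_i\mathbf A(T_i)<\infty$ one has $(T_i)_{\mathcal U}\in\mathfrak A\big((\prod_i X_i)_{\mathcal U},(\prod_i Y_i)_{\mathcal U}\big)$ and $\mathbf A((T_i)_{\mathcal U})\le\lim_{\mathcal U}\mathbf A(T_i)$. * $\mathfrak A$ is maximal if, for all $X,Y$ and all $T\in\mathfrak L(X,Y)$, $\mathbf A(T)=\sup_{E,K}\mathbf A(Q_K^YTJ_E^X)$, the supremum over all finite-dimensional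 subspaces $E\subseteq X$ and all closed finite-codimensional subspaces $K\subseteq Y$, where $\mathbf A(T)=\infty$ means $T\notin\mathfrak A(X,Y)$. * The adjoint $(\mathfrak A^*,\mathbf A^*)$ is defined, for $T\in\mathfrak L(X,Y)$, by $$\mathbf A^*(T)=\sup\{|\mathrm{tr}(TJ_E^XSQ_K^Y)|\},$$ the supremum over all finite-dimensional subspaces $E\subseteq X$, all closed finite-codimensional subspaces $K\subseteq Y$ and all $S\in\mathfrak L(Y/K,E)$ with $\mathbf A(S)\le1$; $\mathfrak A^*(X,Y)$ consists of the $T$ with $\mathbf A^*(T)<\infty$. Further, $\mathbf A^{**}=(\mathbf A^*)^*$. * $\mathfrak A$ satisfies the principle of $\mathfrak A$-local reflexivity if for all Banach spaces $E,Y$ with $\dim E<\infty$, all finite-dimensional subspaces $F\subseteq Y'$, all $T\in\mathfrak L(E,Y'')$ and all $\varepsilon>0$ there is $S\in\mathfrak L(E,Y)$ such that (1) $\mathbf A(S)\le(1+\varepsilon)\mathbf A^{**}(T)$; (2) $\langle Sx,y'\rangle=\langle y',Tx\rangle$ for all $x\in E$, $y'\in F$; (3) $j_YSx=Tx$ for all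 $x\in T^{-1}(j_Y(Y))$. Theorem 3.2. Every Banach ideal that is right-accessible and ultrastable satisfies the principle of $\mathfrak A$-local reflexivity. In particular, every right-accessible maximal Banach ideal satisfies it. -/

import Mathlib

open scoped ENNReal Topology
open Filter

universe u

namespace OpIdeal

instance completeSpace_of_finiteDimensional_submodule {𝕜 : Type} [RCLike 𝕜] {X : Type u}
    [NormedAddCommGroup X] [NormedSpace 𝕜 X] (E : Submodule 𝕜 X) [FiniteDimensional 𝕜 E] :
    CompleteSpace E :=
  FiniteDimensional.complete 𝕜 E

/-- An assignment of a value `val T ∈ [0, ∞]` to every bounded linear operator `T` between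
Banach spaces over `𝕜`. It encodes a class of operators together with a function on it:
`T` belongs to the class exactly when `val T < ∞`. -/
structure OperatorGauge (𝕜 : Type) [RCLike 𝕜] : Type (u + 1) where
  val : ∀ {X Y : Type u} [NormedAddCommGroup X] [NormedSpace 𝕜 X] [CompleteSpace X]
    [NormedAddCommGroup Y] [NormedSpace 𝕜 Y] [CompleteSpace Y], (X →L[𝕜] Y) → ℝ≥0∞

/-- A (normed) Banach operator ideal `(𝔄, A)`: the components are
`𝔄(X, Y) = {T | val T < ∞}` and the ideal norm is `A = val`. -/
structure BanachIdeal (𝕜 : Type) [RCLike 𝕜] : Type (u + 1) extends OperatorGauge.{u} 𝕜 where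
  add_le : ∀ {X Y : Type u} [NormedAddCommGroup X] [NormedSpace 𝕜 X] [CompleteSpace X]
    [NormedAddCommGroup Y] [NormedSpace 𝕜 Y] [CompleteSpace Y] (S T : X →L[𝕜] Y),
    val (S + T) ≤ val S + val T
  smul_eq : ∀ {X Y : Type u} [NormedAddCommGroup X] [NormedSpace 𝕜 X] [CompleteSpace X]
    [NormedAddCommGroup Y] [NormedSpace 𝕜 Y] [CompleteSpace Y] (c : 𝕜) (T : X →L[𝕜] Y),
    val (c • T) = ‖c‖ₑ * val T
  /-- The ideal property `A(RTS) ≤ ‖R‖ A(T) ‖S‖`. -/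
  comp_le : ∀ {W X Y Z : Type u} [NormedAddCommGroup W] [NormedSpace 𝕜 W] [CompleteSpace W]
    [NormedAddCommGroup X] [NormedSpace 𝕜 X] [CompleteSpace X]
    [NormedAddCommGroup Y] [NormedSpace 𝕜 Y] [CompleteSpace Y]
    [NormedAddCommGroup Z] [NormedSpace 𝕜 Z] [CompleteSpace Z]
    (R : Y →L[𝕜] Z) (T : X →L[𝕜] Y) (S : W →L[𝕜] X),
    val (R ∘L T ∘L S) ≤ ‖R‖ₑ * val T * ‖S‖ₑ
  /-- Normalization on rank one operators, `A(x' ⊗ y) = ‖x'‖ ‖y‖`; given the ideal property this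
  is the same as `A(Id_𝕜) = 1`. -/
  rankOne : ∀ {X Y : Type u} [NormedAddCommGroup X] [NormedSpace 𝕜 X] [CompleteSpace X]
    [NormedAddCommGroup Y] [NormedSpace 𝕜 Y] [CompleteSpace Y] (x' : StrongDual 𝕜 X) (y : Y),
    val (x'.smulRight y) = ‖x'‖ₑ * ‖y‖ₑ
  /-- Every component `𝔄(X, Y)` is complete: `A`-Cauchy sequences in it `A`-converge in it. -/
  complete : ∀ {X Y : Type u} [NormedAddCommGroup X] [NormedSpace 𝕜 X] [CompleteSpace X]
    [NormedAddCommGroup Y] [NormedSpace 𝕜 Y] [CompleteSpace Y] (T : ℕ → X →L[𝕜] Y),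
    (∀ n, val (T n) < ∞) →
    (∀ ε : ℝ≥0∞, 0 < ε → ∃ N, ∀ m ≥ N, ∀ n ≥ N, val (T m - T n) < ε) →
    ∃ L : X →L[𝕜] Y, val L < ∞ ∧ Tendsto (fun n => val (T n - L)) atTop (𝓝 0)

section Basic

variable {𝕜 : Type} [RCLike 𝕜]

/-- The trace of a finite rank operator `R` on a vector space: the trace of the endomorphism
that `R` induces on its range. -/
noncomputable def finiteRankTrace {X : Type u} [AddCommGroup X] [Module 𝕜 X] (R : X →ₗ[𝕜] X) : 𝕜 :=
  LinearMap.trace 𝕜 (LinearMap.range R) (R.restrict fun x _ => LinearMap.mem_range_self R x)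

/-- The adjoint `(𝔄*, A*)`: for `T : X → Y`, `A*(T)` is the supremum of `|tr(T J_E S Q_K)|` over
all finite dimensional subspaces `E` of `X` with inclusion `J_E : E → X`, all closed subspaces
`K` of `Y` of finite codimension with quotient map `Q_K : Y → Y/K`, and all `S : Y/K → E` with
`A(S) ≤ 1`. -/
noncomputable def OperatorGauge.adjoint (A : OperatorGauge.{u} 𝕜) : OperatorGauge.{u} 𝕜 where
  val {X Y} _ _ _ _ _ _ T :=
    ⨆ (E : Submodule 𝕜 X) (_ : FiniteDimensional 𝕜 E)
      (K : Submodule 𝕜 Y) (_ : IsClosed (K : Set Y)) (_ : FiniteDimensional 𝕜 (Y ⧸ K))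
      (S : (Y ⧸ K) →L[𝕜] E) (_ : A.val S ≤ 1),
      ‖finiteRankTrace (T ∘L E.subtypeL ∘L S ∘L K.mkQL : Y →L[𝕜] Y).toLinearMap‖ₑ

/-- The maximal hull `(𝔄, A)^max`: for `T : X → Y`, the supremum of `A(Q_K T J_E)` over all finite
dimensional subspaces `E` of `X` and closed finite codimensional subspaces `K` of `Y`. -/
noncomputable def OperatorGauge.maxHull (A : OperatorGauge.{u} 𝕜) : OperatorGauge.{u} 𝕜 where
  val {X Y} _ _ _ _ _ _ T :=
    ⨆ (E : Submodule 𝕜 X) (_ : FiniteDimensional 𝕜 E)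
      (K : Submodule 𝕜 Y) (_ : IsClosed (K : Set Y)) (_ : FiniteDimensional 𝕜 (Y ⧸ K)),
      A.val (K.mkQL ∘L T ∘L E.subtypeL)

/-- `(𝔄, A)` is maximal if it coincides isometrically with its maximal hull. -/
def BanachIdeal.IsMaximal (A : BanachIdeal.{u} 𝕜) : Prop :=
  ∀ (X Y : Type u) [NormedAddCommGroup X] [NormedSpace 𝕜 X] [CompleteSpace X]
    [NormedAddCommGroup Y] [NormedSpace 𝕜 Y] [CompleteSpace Y] (T : X →L[𝕜] Y),
    A.val T = A.toOperatorGauge.maxHull.val T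

/-- Right-accessibility: every `T : E → Y` with `E` finite dimensional factors, for each `ε > 0`,
as `T = J_F S` through a finite dimensional subspace `F` of `Y` with `A(S) ≤ (1 + ε) A(T)`. -/
def BanachIdeal.RightAccessible (A : BanachIdeal.{u} 𝕜) : Prop :=
  ∀ (E Y : Type u) [NormedAddCommGroup E] [NormedSpace 𝕜 E] [CompleteSpace E]
    [FiniteDimensional 𝕜 E]
    [NormedAddCommGroup Y] [NormedSpace 𝕜 Y] [CompleteSpace Y]
    (T : E →L[𝕜] Y) (ε : ℝ), 0 < ε →
    ∃ (F : Submodule 𝕜 Y) (_ : FiniteDimensional 𝕜 F) (S : E →L[𝕜] F),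
      T = F.subtypeL ∘L S ∧ A.val S ≤ ENNReal.ofReal (1 + ε) * A.val T

/-- The principle of `𝔄`-local reflexivity. -/
def BanachIdeal.LocalReflexivity (A : BanachIdeal.{u} 𝕜) : Prop :=
  ∀ (E Y : Type u) [NormedAddCommGroup E] [NormedSpace 𝕜 E] [CompleteSpace E]
    [FiniteDimensional 𝕜 E]
    [NormedAddCommGroup Y] [NormedSpace 𝕜 Y] [CompleteSpace Y]
    (F : Submodule 𝕜 (StrongDual 𝕜 Y)) [FiniteDimensional 𝕜 F]
    (T : E →L[𝕜] StrongDual 𝕜 (StrongDual 𝕜 Y)) (ε : ℝ), 0 < ε →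
    ∃ S : E →L[𝕜] Y,
      A.val S ≤ ENNReal.ofReal (1 + ε) * A.toOperatorGauge.adjoint.adjoint.val
        (X := E) (Y := StrongDual 𝕜 (StrongDual 𝕜 Y)) T ∧
      (∀ x : E, ∀ y' ∈ F, y' (S x) = T x y') ∧
      (∀ x : E, T x ∈ Set.range (NormedSpace.inclusionInDoubleDual 𝕜 Y) →
        NormedSpace.inclusionInDoubleDual 𝕜 Y (S x) = T x)

/-- In a Banach ideal the operator norm is dominated by the ideal norm. -/
theorem BanachIdeal.enorm_le_val (A : BanachIdeal.{u} 𝕜) {X Y : Type u}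
    [NormedAddCommGroup X] [NormedSpace 𝕜 X] [CompleteSpace X]
    [NormedAddCommGroup Y] [NormedSpace 𝕜 Y] [CompleteSpace Y] (T : X →L[𝕜] Y) :
    ‖T‖ₑ ≤ A.val T := by
  rcases eq_or_ne (A.val T) ∞ with h | h
  · simp [h]
  refine ContinuousLinearMap.opENorm_le_bound T fun x => ?_
  rcases eq_or_ne (T x) 0 with h0 | h0
  · simp [h0]
  obtain ⟨φ, hφ, hφx⟩ := exists_dual_vector 𝕜 (T x) (norm_ne_zero_iff.2 h0)
  have hn : ‖T x‖ₑ ≠ 0 := by simpa using h0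
  have ht : ‖T x‖ₑ ≠ ∞ := enorm_ne_top
  have h1 := A.comp_le (φ.smulRight (T x)) T (ContinuousLinearMap.id 𝕜 X)
  have h2 : (φ.smulRight (T x)) ∘L T ∘L (ContinuousLinearMap.id 𝕜 X)
      = (φ ∘L T).smulRight (T x) := by ext; simp
  have hR : ‖φ.smulRight (T x)‖ₑ = ‖T x‖ₑ := by
    rw [← ofReal_norm, ContinuousLinearMap.norm_smulRight_apply, hφ, one_mul, ofReal_norm]
  have hI : ‖ContinuousLinearMap.id 𝕜 X‖ₑ ≤ 1 := by
    rw [← ofReal_norm]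
    exact ENNReal.ofReal_le_one.2 ContinuousLinearMap.norm_id_le
  rw [h2, A.rankOne, hR] at h1
  have h3 : ‖φ ∘L T‖ₑ * ‖T x‖ₑ ≤ A.val T * ‖T x‖ₑ := by
    refine h1.trans ?_
    calc _ ≤ ‖T x‖ₑ * A.val T * 1 := by gcongr
      _ = _ := by ring
  have h4 : ‖φ ∘L T‖ₑ ≤ A.val T := (ENNReal.mul_le_mul_iff_left hn ht).1 h3
  have h5 : ‖T x‖ₑ = ‖(φ ∘L T) x‖ₑ := by
    rw [ContinuousLinearMap.comp_apply, hφx, ← ofReal_norm, ← ofReal_norm]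
    simp
  rw [h5]
  exact (ContinuousLinearMap.le_opENorm _ x).trans (by gcongr)

end Basic

section Ultraproduct

variable {𝕜 : Type} [RCLike 𝕜] {I : Type u}

/-- The subspace of all bounded families `x` with `lim_U ‖x i‖ = 0`. -/
noncomputable def nullSpace (𝕜 : Type) [RCLike 𝕜] (U : Ultrafilter I) (X : I → Type u)
    [∀ i, NormedAddCommGroup (X i)] [∀ i, NormedSpace 𝕜 (X i)] : Submodule 𝕜 (lp X ∞) where
  carrier := {x | Tendsto (fun i => ‖x i‖) U (𝓝 0)}
  zero_mem' := by simp
  add_mem' {x y} hx hy := by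
    have h : Tendsto (fun i => ‖x i‖ + ‖y i‖) U (𝓝 0) := by simpa using Tendsto.add hx hy
    exact squeeze_zero (fun i => norm_nonneg _) (fun i => norm_add_le (x i) (y i)) h
  smul_mem' c x hx := by
    have h : Tendsto (fun i => ‖c‖ * ‖x i‖) U (𝓝 0) := by simpa using Tendsto.const_mul ‖c‖ hx
    exact squeeze_zero (fun i => norm_nonneg _) (fun i => norm_smul_le c (x i)) h

instance isClosed_nullSpace (U : Ultrafilter I) (X : I → Type u)
    [∀ i, NormedAddCommGroup (X i)] [∀ i, NormedSpace 𝕜 (X i)] :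
    IsClosed (nullSpace 𝕜 U X : Set (lp X ∞)) := by
  refine isClosed_of_closure_subset fun x hx => ?_
  refine Metric.tendsto_nhds.2 fun ε hε => ?_
  obtain ⟨y, hy, hxy⟩ := Metric.mem_closure_iff.1 hx (ε / 2) (half_pos hε)
  filter_upwards [Metric.tendsto_nhds.1 hy (ε / 2) (half_pos hε)] with i hi
  have h1 : ‖x i - y i‖ ≤ ‖x - y‖ := lp.norm_apply_le_norm ENNReal.top_ne_zero (x - y) i
  have h2 : ‖x i‖ ≤ ‖x i - y i‖ + ‖y i‖ := by simpa using norm_add_le (x i - y i) (y i)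
  rw [dist_eq_norm] at hxy
  simp only [Real.dist_eq, sub_zero, abs_norm] at hi ⊢
  linarith

/-- The ultraproduct `(∏ X_i)_U` of a family of Banach spaces: the quotient of `ℓ_∞(X_i; I)` by
the closed subspace of all `x` with `lim_U ‖x i‖ = 0`, with the quotient norm. -/
abbrev Ultraproduct (𝕜 : Type) [RCLike 𝕜] (U : Ultrafilter I) (X : I → Type u)
    [∀ i, NormedAddCommGroup (X i)] [∀ i, NormedSpace 𝕜 (X i)] : Type u :=
  lp X ∞ ⧸ nullSpace 𝕜 U X

variable {X Y : I → Type u} [∀ i, NormedAddCommGroup (X i)] [∀ i, NormedSpace 𝕜 (X i)]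
  [∀ i, NormedAddCommGroup (Y i)] [∀ i, NormedSpace 𝕜 (Y i)]

/-- The operator `(x i) ↦ (T i (x i))` from `ℓ_∞(X_i; I)` to `ℓ_∞(Y_i; I)` given by a uniformly
bounded family of operators. -/
noncomputable def diagonalMap (T : ∀ i, X i →L[𝕜] Y i)
    (hT : BddAbove (Set.range fun i => ‖T i‖)) : lp X ∞ →L[𝕜] lp Y ∞ :=
  LinearMap.mkContinuous
    { toFun := fun x => ⟨fun i => T i (x i), memℓp_infty ⟨hT.some * ‖x‖, by
        rintro _ ⟨i, rfl⟩
        have h : ‖T i‖ ≤ hT.some := hT.some_mem ⟨i, rfl⟩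
        exact ((T i).le_opNorm _).trans (mul_le_mul h
          (lp.norm_apply_le_norm ENNReal.top_ne_zero x i) (norm_nonneg _)
          ((norm_nonneg _).trans h))⟩⟩
      map_add' := fun x y => by ext i; exact map_add (T i) (x i) (y i)
      map_smul' := fun c x => by ext i; exact map_smul (T i) c (x i) }
    (max hT.some 0) fun x => by
      refine lp.norm_le_of_forall_le (by positivity) fun i => ?_
      have h : ‖T i‖ ≤ hT.some := hT.some_mem ⟨i, rfl⟩
      exact ((T i).le_opNorm _).trans (mul_le_mul (h.trans (le_max_left _ _))
        (lp.norm_apply_le_norm ENNReal.top_ne_zero x i) (norm_nonneg _) (le_max_right _ _))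

/-- The ultraproduct `(T_i)_U` of a uniformly bounded family of operators, given by
`(x_i)_U ↦ (T_i x_i)_U`. -/
noncomputable def ultraproductMap (U : Ultrafilter I) (T : ∀ i, X i →L[𝕜] Y i)
    (hT : BddAbove (Set.range fun i => ‖T i‖)) :
    Ultraproduct 𝕜 U X →L[𝕜] Ultraproduct 𝕜 U Y :=
  (nullSpace 𝕜 U X).liftQL ((nullSpace 𝕜 U Y).mkQL ∘L diagonalMap T hT) <| by
    intro x hx
    have h : diagonalMap T hT x ∈ nullSpace 𝕜 U Y := by
      have h0 : Tendsto (fun i => hT.some * ‖x i‖) U (𝓝 0) := by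
        simpa using Tendsto.const_mul hT.some (show Tendsto (fun i => ‖x i‖) U (𝓝 0) from hx)
      refine squeeze_zero (fun i => norm_nonneg _) (fun i => ?_) h0
      have h : ‖T i‖ ≤ hT.some := hT.some_mem ⟨i, rfl⟩
      exact ((T i).le_opNorm _).trans (mul_le_mul_of_nonneg_right h (norm_nonneg _))
    simpa using h

theorem ultraproductMap_mk (U : Ultrafilter I) (T : ∀ i, X i →L[𝕜] Y i)
    (hT : BddAbove (Set.range fun i => ‖T i‖)) (x : lp X ∞) :
    ultraproductMap U T hT ((nullSpace 𝕜 U X).mkQ x)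
      = (nullSpace 𝕜 U Y).mkQ (diagonalMap T hT x) := rfl

/-- An `A`-bounded family of operators is uniformly bounded in operator norm. -/
theorem BanachIdeal.bddAbove_norm [∀ i, CompleteSpace (X i)] [∀ i, CompleteSpace (Y i)]
    (A : BanachIdeal.{u} 𝕜) (T : ∀ i, X i →L[𝕜] Y i) (hT : (⨆ i, A.val (T i)) < ∞) :
    BddAbove (Set.range fun i => ‖T i‖) := by
  refine ⟨(⨆ i, A.val (T i)).toReal, ?_⟩
  rintro _ ⟨i, rfl⟩
  have h : ‖T i‖ₑ ≤ ⨆ i, A.val (T i) := (A.enorm_le_val (T i)).trans (le_iSup (fun i => A.val (T i)) i)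
  simpa using ENNReal.toReal_mono hT.ne h

/-- `(𝔄, A)` is ultrastable if for every ultrafilter `U` on a set `I` and every `A`-bounded family
of operators `T_i ∈ 𝔄(X_i, Y_i)` the ultraproduct `(T_i)_U` belongs to `𝔄` and satisfies
`A((T_i)_U) ≤ lim_U A(T_i)`. The limit `l` exists and is finite, as the family is bounded. -/
def BanachIdeal.Ultrastable (A : BanachIdeal.{u} 𝕜) : Prop :=
  ∀ (I : Type u) (U : Ultrafilter I) (X Y : I → Type u)
    [∀ i, NormedAddCommGroup (X i)] [∀ i, NormedSpace 𝕜 (X i)] [∀ i, CompleteSpace (X i)]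
    [∀ i, NormedAddCommGroup (Y i)] [∀ i, NormedSpace 𝕜 (Y i)] [∀ i, CompleteSpace (Y i)]
    (T : ∀ i, X i →L[𝕜] Y i) (hT : (⨆ i, A.val (T i)) < ∞) (l : ℝ≥0∞),
    Tendsto (fun i => A.val (T i)) U (𝓝 l) →
    A.val (ultraproductMap U T (A.bddAbove_norm T hT)) < ∞ ∧
      A.val (ultraproductMap U T (A.bddAbove_norm T hT)) ≤ l

end Ultraproduct

end OpIdeal

/-! Let `T : E → Y''`. Right-accessibility writes `T` as `S` followed by the inclusion of a
finite-dimensional `F ⊆ Y''`, with `A(S) ≤ (1 + η) A(T)`. Classical local reflexivity replaces that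
inclusion by `R : F → Y` with `‖R‖ < 1 + η` subject to the two constraints, so `R ∘ S` satisfies
them and `A(R ∘ S) ≤ (1 + η)² A(T)`. It remains to see `A(T) ≤ A**(T)`, which passes through the
maximal hull.

The hull is dominated by `A**` in every Banach ideal, by Hahn–Banach and trace duality
(`maxHull_le_adjoint_adjoint`). That `A(T)` is at most its hull is immediate for maximal ideals. For
ultrastable ones it holds because the target is a dual space: `T` is a weak-star limit of its
compositions with finite-dimensional quotients, hence factors through their ultraproduct with
contractions on both sides (`val_le_of_weakStarLim`, `val_comp_le_maxHull`).

Classical local reflexivity (`exists_lift_of_bidual_norm_lt`) is a duality argument in `L(F, Y)`: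
any lift `R₀` meeting the constraints has distance at most `M` from the operators satisfying the
homogeneous constraints (`norm_dual_apply_le_of_lift`). -/

namespace OpIdeal

/-! ### Traces of finite-rank operators and trace duality. -/

section Trace

/-- Cyclicity of the trace, used twice through the finite-dimensional range of `a`; this permits `Y`
to be infinite-dimensional. -/
theorem finiteRankTrace_comp {𝕜 : Type} [RCLike 𝕜] {V : Type*} {Y : Type u} [AddCommGroup V]
    [Module 𝕜 V] [FiniteDimensional 𝕜 V] [AddCommGroup Y] [Module 𝕜 Y]
    (a : V →ₗ[𝕜] Y) (b : Y →ₗ[𝕜] V) :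
    finiteRankTrace (a ∘ₗ b) = LinearMap.trace 𝕜 V (b ∘ₗ a) := by
  have hPW : LinearMap.range (a ∘ₗ b) ≤ LinearMap.range a := LinearMap.range_comp_le_range b a
  have : FiniteDimensional 𝕜 (LinearMap.range (a ∘ₗ b)) := Submodule.finiteDimensional_of_le hPW
  set j := Submodule.inclusion hPW
  set g : LinearMap.range a →ₗ[𝕜] LinearMap.range (a ∘ₗ b) :=
    (a ∘ₗ b).rangeRestrict ∘ₗ (LinearMap.range a).subtype
  have h1 : b ∘ₗ a = (b ∘ₗ (LinearMap.range a).subtype) ∘ₗ a.rangeRestrict := by ext; simp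
  have h2 : a.rangeRestrict ∘ₗ (b ∘ₗ (LinearMap.range a).subtype) = j ∘ₗ g := by
    ext x; simp [j, g]
  rw [h1, LinearMap.trace_comp_comm', h2, LinearMap.trace_comp_comm']
  rfl

theorem eq_sum_coord_smulRight {𝕜 : Type} [RCLike 𝕜] {G H : Type*}
    [NormedAddCommGroup G] [NormedSpace 𝕜 G] [FiniteDimensional 𝕜 G]
    [NormedAddCommGroup H] [NormedSpace 𝕜 H] {ι : Type*} [Fintype ι] (b : Module.Basis ι 𝕜 G)
    (V : G →L[𝕜] H) :
    V = ∑ i, (LinearMap.toContinuousLinearMap (b.coord i) : StrongDual 𝕜 G).smulRight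
      (V (b i)) := by
  ext x
  have h := congrArg V (b.sum_repr x)
  rw [map_sum] at h
  simpa using h.symm

/-- An operator is a sum of rank-one operators `c i ⊗ h`, so `φ` is determined by the functionals `h
↦ φ (c i ⊗ h)`; these are the coordinates of `S`. -/
theorem exists_eq_trace_comp {𝕜 : Type} [RCLike 𝕜] {G H : Type*}
    [NormedAddCommGroup G] [NormedSpace 𝕜 G] [FiniteDimensional 𝕜 G]
    [NormedAddCommGroup H] [NormedSpace 𝕜 H] [FiniteDimensional 𝕜 H]
    (φ : (G →L[𝕜] H) →ₗ[𝕜] 𝕜) :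
    ∃ S : H →L[𝕜] G, ∀ V : G →L[𝕜] H,
      φ V = LinearMap.trace 𝕜 G (S.toLinearMap ∘ₗ V.toLinearMap) := by
  let b := Module.finBasis 𝕜 G
  let c i : StrongDual 𝕜 G := LinearMap.toContinuousLinearMap (b.coord i)
  let ψ i : H →ₗ[𝕜] 𝕜 := φ ∘ₗ (ContinuousLinearMap.smulRightL 𝕜 G H (c i)).toLinearMap
  let S : H →ₗ[𝕜] G := ∑ i, (ψ i).smulRight (b i)
  refine ⟨LinearMap.toContinuousLinearMap S, fun V => ?_⟩
  have hS : S ∘ₗ V.toLinearMap = ∑ i, (ψ i ∘ₗ V.toLinearMap).smulRight (b i) := by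
    ext x; simp [S]
  conv_lhs => rw [eq_sum_coord_smulRight b V]
  change _ = LinearMap.trace 𝕜 G (S ∘ₗ V.toLinearMap)
  rw [hS]
  simp [ψ, c]

end Trace

/-! ### The maximal hull is dominated by the biadjoint. -/

section Biadjoint

theorem norm_mkQL_le_one {𝕜 : Type} [RCLike 𝕜] {Y : Type*} [NormedAddCommGroup Y] [NormedSpace 𝕜 Y]
    (K : Submodule 𝕜 Y) : ‖K.mkQL‖ ≤ 1 :=
  ContinuousLinearMap.opNorm_le_bound _ zero_le_one fun x => by
    simpa using Submodule.Quotient.norm_mk_le (S := K) x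

variable {𝕜 : Type} [RCLike 𝕜] (A : BanachIdeal.{u} 𝕜)
variable {W X Y Z : Type u} [NormedAddCommGroup X] [NormedSpace 𝕜 X] [CompleteSpace X]
    [NormedAddCommGroup Y] [NormedSpace 𝕜 Y] [CompleteSpace Y]
    [NormedAddCommGroup W] [NormedSpace 𝕜 W] [CompleteSpace W]
    [NormedAddCommGroup Z] [NormedSpace 𝕜 Z] [CompleteSpace Z]

theorem BanachIdeal.val_zero : A.val (0 : X →L[𝕜] Y) = 0 := by
  simpa using A.smul_eq (0 : 𝕜) (0 : X →L[𝕜] Y)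

theorem BanachIdeal.val_sum_le {ι : Type*} (s : Finset ι) (T : ι → X →L[𝕜] Y) :
    A.val (∑ i ∈ s, T i) ≤ ∑ i ∈ s, A.val (T i) :=
  Finset.le_sum_of_subadditive _ A.val_zero.le A.add_le s T

theorem BanachIdeal.val_lt_top [FiniteDimensional 𝕜 X] (T : X →L[𝕜] Y) : A.val T < ∞ := by
  rw [eq_sum_coord_smulRight (Module.finBasis 𝕜 X) T]
  refine (A.val_sum_le _ _).trans_lt (ENNReal.sum_lt_top.2 fun i _ => ?_)
  rw [A.rankOne]
  exact ENNReal.mul_lt_top enorm_lt_top enorm_lt_top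

theorem BanachIdeal.val_comp_left_le (R : Y →L[𝕜] Z) (T : X →L[𝕜] Y) :
    A.val (R ∘L T) ≤ ‖R‖ₑ * A.val T := by
  refine (A.comp_le R T (.id 𝕜 X)).trans ?_
  have : ‖ContinuousLinearMap.id 𝕜 X‖ₑ ≤ 1 := by
    rw [← ofReal_norm]
    exact ENNReal.ofReal_le_one.2 ContinuousLinearMap.norm_id_le
  calc _ ≤ ‖R‖ₑ * A.val T * 1 := by gcongr
    _ = _ := mul_one _

theorem BanachIdeal.val_comp_le_of_norm_le_one (R : Y →L[𝕜] Z) (T : X →L[𝕜] Y) (S : W →L[𝕜] X)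
    (hR : ‖R‖ ≤ 1) (hS : ‖S‖ ≤ 1) : A.val (R ∘L T ∘L S) ≤ A.val T := by
  have hR' : ‖R‖ₑ ≤ 1 := by rw [← ofReal_norm]; exact ENNReal.ofReal_le_one.2 hR
  have hS' : ‖S‖ₑ ≤ 1 := by rw [← ofReal_norm]; exact ENNReal.ofReal_le_one.2 hS
  calc _ ≤ ‖R‖ₑ * A.val T * ‖S‖ₑ := A.comp_le R T S
    _ ≤ 1 * A.val T * 1 := by gcongr
    _ = _ := by simp

/-- The ideal norm as a seminorm on the operators with finite-dimensional domain. -/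
noncomputable def BanachIdeal.seminorm (X Y : Type u) [NormedAddCommGroup X] [NormedSpace 𝕜 X]
    [CompleteSpace X] [NormedAddCommGroup Y] [NormedSpace 𝕜 Y] [CompleteSpace Y]
    [FiniteDimensional 𝕜 X] : Seminorm 𝕜 (X →L[𝕜] Y) :=
  Seminorm.of (fun T => (A.val T).toReal)
    (fun S T => by
      rw [← ENNReal.toReal_add (A.val_lt_top S).ne (A.val_lt_top T).ne]
      exact ENNReal.toReal_mono (ENNReal.add_lt_top.2 ⟨A.val_lt_top S, A.val_lt_top T⟩).ne
        (A.add_le S T))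
    (fun c T => by rw [A.smul_eq, ENNReal.toReal_mul, toReal_enorm])

/-- Hahn–Banach for the ideal norm, which is a finite seminorm because the domain is
finite-dimensional: `c • R ↦ c A(R)` is extended from the span of `R`. -/
theorem BanachIdeal.exists_dual_functional [FiniteDimensional 𝕜 X] (R : X →L[𝕜] Y) :
    ∃ φ : (X →L[𝕜] Y) →ₗ[𝕜] 𝕜, ‖φ R‖ₑ = A.val R ∧ ∀ V, ‖φ V‖ₑ ≤ A.val V := by
  rcases eq_or_ne R 0 with rfl | hR
  · exact ⟨0, by simp [A.val_zero], by simp⟩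
  let e := LinearEquiv.toSpanNonzeroSingleton 𝕜 _ R hR
  let f : Module.Dual 𝕜 (Submodule.span 𝕜 {R}) :=
    (((A.val R).toReal : 𝕜) • LinearMap.id) ∘ₗ e.symm.toLinearMap
  obtain ⟨φ, h1, h2⟩ := Module.Dual.exists_extension_of_le_seminorm _ f
    (p := A.seminorm X Y) (fun x => by
      obtain ⟨c, rfl⟩ := e.surjective x
      have h : ((e c : Submodule.span 𝕜 {R}) : X →L[𝕜] Y) = c • R := by simp [e]
      change ‖f (e c)‖ ≤ (A.val (e c : X →L[𝕜] Y)).toReal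
      rw [h, A.smul_eq]
      simp [f, norm_smul, mul_comm, -LinearEquiv.toSpanNonzeroSingleton_apply, e.symm_apply_apply])
  have key : ∀ V, ‖φ V‖ₑ ≤ A.val V := fun V => by
    have := h2 V
    rw [← ofReal_norm]
    exact ENNReal.ofReal_le_of_le_toReal this
  refine ⟨φ, ?_, key⟩
  have h3 := h1 (e 1)
  have h4 : ((e 1 : Submodule.span 𝕜 {R}) : X →L[𝕜] Y) = R := by simp [e]
  rw [h4] at h3
  rw [h3, ← ofReal_norm]
  simp [f, ENNReal.ofReal_toReal (A.val_lt_top R).ne]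

/-- A functional norming `Q_K T J_E` is, by trace duality, given by some `S : Y/K → E`. Being
`A`-contractive, it makes `A*(S) ≤ 1`, so `S` competes in the supremum defining `A**(T)`. -/
theorem BanachIdeal.maxHull_le_adjoint_adjoint (T : X →L[𝕜] Y) :
    A.toOperatorGauge.maxHull.val T ≤ A.toOperatorGauge.adjoint.adjoint.val T := by
  refine iSup_le fun E => iSup_le fun hE => iSup_le fun K => iSup_le fun hK => iSup_le fun hKf => ?_
  obtain ⟨φ, hφR, hφ⟩ := A.exists_dual_functional (K.mkQL ∘L T ∘L E.subtypeL)
  obtain ⟨S, hS⟩ := exists_eq_trace_comp φ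
  -- By cyclicity each trace tested by `A*(S)` is the value of `φ` at an operator `E → Y/K` of ideal
  -- norm at most one.
  have hS1 : A.toOperatorGauge.adjoint.val S ≤ 1 := by
    refine iSup_le fun E' => iSup_le fun hE' => iSup_le fun K' => iSup_le fun hK' =>
      iSup_le fun hKf' => iSup_le fun V => iSup_le fun hV => ?_
    have h : finiteRankTrace (S ∘L E'.subtypeL ∘L V ∘L K'.mkQL : E →L[𝕜] E).toLinearMap
        = φ (E'.subtypeL ∘L V ∘L K'.mkQL) := by
      rw [hS]
      have := finiteRankTrace_comp (𝕜 := 𝕜) (V := Y ⧸ K) S.toLinearMap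
        (E'.subtypeL ∘L V ∘L K'.mkQL).toLinearMap
      rw [LinearMap.trace_comp_comm'] at this
      exact this
    rw [h]
    refine (hφ _).trans (le_trans ?_ hV)
    exact A.val_comp_le_of_norm_le_one _ _ _ E'.norm_subtypeL_le (norm_mkQL_le_one K')
  have h : finiteRankTrace (T ∘L E.subtypeL ∘L S ∘L K.mkQL : Y →L[𝕜] Y).toLinearMap
      = φ (K.mkQL ∘L T ∘L E.subtypeL) := by
    rw [hS]
    exact finiteRankTrace_comp (𝕜 := 𝕜) (V := E) (T ∘L E.subtypeL).toLinearMap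
      (S ∘L K.mkQL).toLinearMap
  rw [← hφR, ← h]
  exact le_iSup_of_le E <| le_iSup_of_le hE <| le_iSup_of_le K <| le_iSup_of_le hK <|
    le_iSup_of_le hKf <| le_iSup_of_le S <| le_iSup_of_le hS1 le_rfl

end Biadjoint

/-! ### Weak-star limits along ultrafilters. -/

section WeakStarLimit

theorem norm_liftQL_le {𝕜 : Type} [RCLike 𝕜] {Y Z : Type*} [NormedAddCommGroup Y]
    [NormedSpace 𝕜 Y] [NormedAddCommGroup Z] [NormedSpace 𝕜 Z] (K : Submodule 𝕜 Y)
    (f : Y →L[𝕜] Z) (h : K ≤ f.ker) : ‖K.liftQL f h‖ ≤ ‖f‖ := by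
  refine ContinuousLinearMap.opNorm_le_bound _ (norm_nonneg _) fun x => ?_
  refine le_of_forall_pos_le_add fun ε hε => ?_
  have hc : 0 < ‖f‖ + 1 := by positivity
  obtain ⟨m, rfl, hm⟩ := Submodule.Quotient.norm_mk_lt x (div_pos hε hc)
  calc ‖f m‖ ≤ ‖f‖ * ‖m‖ := f.le_opNorm m
    _ ≤ ‖f‖ * (‖(Submodule.Quotient.mk m : Y ⧸ K)‖ + ε / (‖f‖ + 1)) := by gcongr
    _ = ‖f‖ * ‖(Submodule.Quotient.mk m : Y ⧸ K)‖ + ‖f‖ * (ε / (‖f‖ + 1)) := mul_add _ _ _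
    _ ≤ ‖f‖ * ‖(Submodule.Quotient.mk m : Y ⧸ K)‖ + (‖f‖ + 1) * (ε / (‖f‖ + 1)) := by
      gcongr; linarith
    _ = _ := by rw [mul_div_cancel₀ _ hc.ne']

theorem tendsto_limUnder_of_norm_le {𝕜 : Type} [RCLike 𝕜] {I : Type*} (U : Ultrafilter I)
    {f : I → 𝕜} {C : ℝ} (hf : ∀ i, ‖f i‖ ≤ C) : Tendsto f U (𝓝 (limUnder U f)) := by
  obtain ⟨c, -, hc⟩ := (isCompact_closedBall (0 : 𝕜) C).ultrafilter_le_nhds (U.map f) <| by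
    rw [le_principal_iff, Ultrafilter.coe_map, mem_map]
    exact univ_mem' fun i => by simpa using hf i
  exact tendsto_nhds_limUnder ⟨c, hc⟩

variable {𝕜 : Type} [RCLike 𝕜] {W I : Type u} [NormedAddCommGroup W]
  {Q : I → Type u} [∀ i, NormedAddCommGroup (Q i)] [∀ i, NormedSpace 𝕜 (Q i)]

theorem norm_dual_apply_le_of_norm_le {e : ∀ i, W → StrongDual 𝕜 (Q i)}
    (he : ∀ i w, ‖e i w‖ ≤ ‖w‖) (x : lp Q ∞) (w : W) (i : I) :
    ‖e i w (x i)‖ ≤ ‖x‖ * ‖w‖ := by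
  rw [mul_comm]
  exact ((e i w).le_opNorm _).trans <| mul_le_mul (he i w)
    (lp.norm_apply_le_norm ENNReal.top_ne_zero x i) (norm_nonneg _) (norm_nonneg _)

/-- Weak-star limits along an ultrafilter: a family of maps `W → (Q i)'` of norm at most one
that is linear in the limit induces a contraction from the ultraproduct of the `Q i` to `W'`. -/
theorem exists_weakStarLim [NormedSpace 𝕜 W] (U : Ultrafilter I) (e : ∀ i, W → StrongDual 𝕜 (Q i))
    (he : ∀ i w, ‖e i w‖ ≤ ‖w‖)
    (hadd : ∀ v w, ∀ᶠ i in (U : Filter I), e i (v + w) = e i v + e i w)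
    (hsmul : ∀ (c : 𝕜) w, ∀ᶠ i in (U : Filter I), e i (c • w) = c • e i w) :
    ∃ P : Ultraproduct 𝕜 U Q →L[𝕜] StrongDual 𝕜 W, ‖P‖ ≤ 1 ∧ ∀ (x : lp Q ∞) (w : W),
      Tendsto (fun i => e i w (x i)) U (𝓝 (P ((nullSpace 𝕜 U Q).mkQ x) w)) := by
  have hlim (x : lp Q ∞) (w : W) : Tendsto (fun i => e i w (x i)) U
      (𝓝 (limUnder U fun i => e i w (x i))) :=
    tendsto_limUnder_of_norm_le U (norm_dual_apply_le_of_norm_le he x w)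
  let B : lp Q ∞ →ₗ[𝕜] W →ₗ[𝕜] 𝕜 :=
    LinearMap.mk₂ 𝕜 (fun x w => limUnder U fun i => e i w (x i))
      (fun x y w => by
        refine tendsto_nhds_unique (hlim (x + y) w) ?_
        simpa using (hlim x w).add (hlim y w))
      (fun c x w => by
        refine tendsto_nhds_unique (hlim (c • x) w) ?_
        simpa using (hlim x w).const_smul c)
      (fun x v w => by
        refine tendsto_nhds_unique (hlim x (v + w)) ?_
        refine ((hlim x v).add (hlim x w)).congr' ?_
        filter_upwards [hadd v w] with i hi
        simp [hi])
      (fun c x w => by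
        refine tendsto_nhds_unique (hlim x (c • w)) ?_
        refine ((hlim x w).const_smul c).congr' ?_
        filter_upwards [hsmul c w] with i hi
        simp [hi])
  have hB (x : lp Q ∞) (w : W) : ‖B x w‖ ≤ 1 * ‖x‖ * ‖w‖ := by
    rw [one_mul]
    exact le_of_tendsto (hlim x w).norm (univ_mem' (norm_dual_apply_le_of_norm_le he x w))
  refine ⟨(nullSpace 𝕜 U Q).liftQL (B.mkContinuous₂ 1 hB) fun x hx => ?_,
    (norm_liftQL_le _ _ _).trans (LinearMap.mkContinuous₂_norm_le _ zero_le_one hB), hlim⟩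
  change B.mkContinuous₂ 1 hB x = 0
  ext w
  refine tendsto_nhds_unique (hlim x w) ?_
  have h : Tendsto (fun i => ‖w‖ * ‖x i‖) U (𝓝 0) := by
    simpa using Tendsto.const_mul ‖w‖ (show Tendsto (fun i => ‖x i‖) U (𝓝 0) from hx)
  exact squeeze_zero_norm (fun i => ((e i w).le_opNorm _).trans (by gcongr; exact he i w)) h

end WeakStarLimit

/-! ### Ideal norms of weak-star limits under ultrastability. -/

section Diagonal

variable {𝕜 : Type} [RCLike 𝕜] {X : Type u} [NormedAddCommGroup X] [NormedSpace 𝕜 X]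

variable (𝕜 X) in
/-- The embedding of a space into the bounded families as constant families. -/
noncomputable def constFamily (I : Type u) : X →L[𝕜] lp (fun _ : I => X) ∞ :=
  LinearMap.mkContinuous
    { toFun := fun x => ⟨fun _ => x, memℓp_infty ⟨‖x‖, by rintro _ ⟨i, rfl⟩; rfl⟩⟩
      map_add' := fun x y => rfl
      map_smul' := fun c x => rfl } 1 fun x => by
    rw [one_mul]
    exact lp.norm_le_of_forall_le (norm_nonneg _) fun _ => le_rfl

theorem norm_constFamily_le (I : Type u) : ‖constFamily 𝕜 X I‖ ≤ 1 :=
  LinearMap.mkContinuous_norm_le _ zero_le_one _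

end Diagonal

theorem BanachIdeal.val_mkQL_comp_le_maxHull {𝕜 : Type} [RCLike 𝕜] (A : BanachIdeal.{u} 𝕜)
    {E Y : Type u} [NormedAddCommGroup E] [NormedSpace 𝕜 E] [CompleteSpace E]
    [FiniteDimensional 𝕜 E] [NormedAddCommGroup Y] [NormedSpace 𝕜 Y] [CompleteSpace Y]
    (T : E →L[𝕜] Y) (K : Submodule 𝕜 Y) [hK : IsClosed (K : Set Y)]
    [hKf : FiniteDimensional 𝕜 (Y ⧸ K)] :
    A.val (K.mkQL ∘L T) ≤ A.toOperatorGauge.maxHull.val T := by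
  refine le_trans ?_ (le_iSup_of_le ⊤ <| le_iSup_of_le inferInstance <| le_iSup_of_le K <|
    le_iSup_of_le hK <| le_iSup_of_le hKf le_rfl)
  exact A.val_comp_le_of_norm_le_one (.id 𝕜 _) (K.mkQL ∘L T ∘L (⊤ : Submodule 𝕜 E).subtypeL)
    ((ContinuousLinearMap.id 𝕜 E).codRestrict ⊤ fun _ => trivial)
    ContinuousLinearMap.norm_id_le
    (ContinuousLinearMap.opNorm_le_bound _ zero_le_one fun x => by rw [one_mul]; rfl)

/-- An operator into a dual space that is a weak-star limit of operators `T i` belongs to an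
ultrastable ideal if the `T i` do with bounded ideal norms. -/
theorem BanachIdeal.Ultrastable.val_le_of_weakStarLim {𝕜 : Type} [RCLike 𝕜] {A : BanachIdeal.{u} 𝕜}
    (hA : A.Ultrastable) {E W I : Type u} [NormedAddCommGroup E] [NormedSpace 𝕜 E]
    [CompleteSpace E] [NormedAddCommGroup W] [NormedSpace 𝕜 W]
    {Q : I → Type u} [∀ i, NormedAddCommGroup (Q i)] [∀ i, NormedSpace 𝕜 (Q i)]
    [∀ i, CompleteSpace (Q i)] (U : Ultrafilter I) (e : ∀ i, W → StrongDual 𝕜 (Q i))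
    (he : ∀ i w, ‖e i w‖ ≤ ‖w‖)
    (hadd : ∀ v w, ∀ᶠ i in (U : Filter I), e i (v + w) = e i v + e i w)
    (hsmul : ∀ (c : 𝕜) w, ∀ᶠ i in (U : Filter I), e i (c • w) = c • e i w)
    (S : ∀ i, E →L[𝕜] Q i) (T : E →L[𝕜] StrongDual 𝕜 W)
    (hT : ∀ x w, ∀ᶠ i in (U : Filter I), e i w (S i x) = T x w)
    {C : ℝ≥0∞} (hC : C < ∞) (hS : ∀ i, A.val (S i) ≤ C) : A.val T ≤ C := by
  obtain ⟨P, hP, hlim⟩ := exists_weakStarLim U e he hadd hsmul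
  have hsup : (⨆ i, A.val (S i)) < ∞ := (iSup_le hS).trans_lt hC
  -- The limit along `U` exists because `[0, ∞]` is compact.
  obtain ⟨l, -, hl⟩ := isCompact_univ.ultrafilter_le_nhds (U.map fun i => A.val (S i)) (by simp)
  have hl' : Tendsto (fun i => A.val (S i)) U (𝓝 l) := hl
  obtain ⟨-, hle⟩ := hA I U _ _ S hsup l hl'
  refine le_trans ?_ (hle.trans (le_of_tendsto hl' (univ_mem' hS)))
  let D := (nullSpace 𝕜 U fun _ : I => E).mkQL ∘L constFamily 𝕜 E I
  have hD : ‖D‖ ≤ 1 := by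
    refine (ContinuousLinearMap.opNorm_comp_le _ _).trans ?_
    exact mul_le_one₀ (norm_mkQL_le_one _) (norm_nonneg _) (norm_constFamily_le _)
  -- `T` factors through the ultraproduct: constant families, then `(S i)_U`, then the weak-star
  -- limit map.
  have hTD : T = P ∘L ultraproductMap U S (A.bddAbove_norm S hsup) ∘L D := by
    ext x w
    refine tendsto_nhds_unique ?_
      (hlim (diagonalMap S (A.bddAbove_norm S hsup) (constFamily 𝕜 E I x)) w)
    refine tendsto_const_nhds.congr' ?_
    filter_upwards [hT x w] with i hi
    exact hi.symm
  conv_lhs => rw [hTD]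
  exact A.val_comp_le_of_norm_le_one P _ D hP hD

/-! ### Dual-valued operators as limits of finite-dimensional quotients. -/

section Annihilator

variable {𝕜 : Type} [RCLike 𝕜] {W Z : Type u} [NormedAddCommGroup Z] [NormedSpace 𝕜 Z]

/-- The common kernel of the functionals `j w`, `w ∈ s`. -/
noncomputable def finAnnihilator (j : W → StrongDual 𝕜 Z) (s : Finset W) : Submodule 𝕜 Z :=
  (ContinuousLinearMap.pi fun w : s => j w).ker

variable {j : W → StrongDual 𝕜 Z}

theorem mem_finAnnihilator {s : Finset W} {z : Z} :
    z ∈ finAnnihilator j s ↔ ∀ w ∈ s, j w z = 0 := by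
  simp [finAnnihilator, funext_iff]

instance isClosed_finAnnihilator (s : Finset W) : IsClosed (finAnnihilator j s : Set Z) :=
  ContinuousLinearMap.isClosed_ker _

instance finiteDimensional_quotient_finAnnihilator (s : Finset W) :
    FiniteDimensional 𝕜 (Z ⧸ finAnnihilator j s) :=
  Module.Finite.equiv (LinearMap.quotKerEquivRange
    (ContinuousLinearMap.pi fun w : s => j w).toLinearMap).symm

open Classical in
/-- The functional induced by `j w` on the quotient by the common kernel of the `j v`, `v ∈ s`,
when `w ∈ s`. -/
noncomputable def quotientEval (j : W → StrongDual 𝕜 Z) (s : Finset W) (w : W) :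
    StrongDual 𝕜 (Z ⧸ finAnnihilator j s) :=
  if hw : w ∈ s then (finAnnihilator j s).liftQL (j w) fun _ hz => mem_finAnnihilator.1 hz w hw
  else 0

theorem quotientEval_mkQ {s : Finset W} {w : W} (hw : w ∈ s) (z : Z) :
    quotientEval j s w ((finAnnihilator j s).mkQ z) = j w z := by
  rw [quotientEval, dif_pos hw]; rfl

theorem norm_quotientEval_le (s : Finset W) (w : W) : ‖quotientEval j s w‖ ≤ ‖j w‖ := by
  by_cases hw : w ∈ s
  · rw [quotientEval, dif_pos hw]
    exact norm_liftQL_le _ _ _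
  · simp [quotientEval, dif_neg hw]

theorem quotient_dual_ext {K : Submodule 𝕜 Z} {f g : StrongDual 𝕜 (Z ⧸ K)}
    (h : ∀ z, f (K.mkQ z) = g (K.mkQ z)) : f = g := by
  ext q
  obtain ⟨z, rfl⟩ := K.mkQ_surjective q
  exact h z

/-- For finite `s ⊆ W`, quotienting `Z` by the common kernel of the functionals `z ↦ R z w`, `w ∈
s`, retains every value `R (T x) w` with `w ∈ s`. These quotients of `T` have ideal norm at most the
hull and recover `R ∘ T` in the weak-star limit over `s`. -/
theorem BanachIdeal.Ultrastable.val_comp_le_maxHull {A : BanachIdeal.{u} 𝕜} (hA : A.Ultrastable)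
    [NormedAddCommGroup W] [NormedSpace 𝕜 W] {E : Type u} [NormedAddCommGroup E] [NormedSpace 𝕜 E] [CompleteSpace E]
    [FiniteDimensional 𝕜 E] [CompleteSpace Z] (T : E →L[𝕜] Z) (R : Z →L[𝕜] StrongDual 𝕜 W)
    (hR : ‖R‖ ≤ 1) : A.val (R ∘L T) ≤ A.toOperatorGauge.maxHull.val T := by
  rcases eq_or_ne (A.toOperatorGauge.maxHull.val T) ∞ with h | hM
  · simp [h]
  -- An ultrafilter refining the order filter on finite sets: each `w` eventually lies in `s`.
  let U : Ultrafilter (Finset W) := Ultrafilter.of atTop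
  have hU (w : W) : ∀ᶠ s in (U : Filter (Finset W)), w ∈ s := by
    filter_upwards [Ultrafilter.of_le atTop (eventually_ge_atTop {w})] with s hs
    simpa using hs
  have hj w : ‖R.flip w‖ ≤ ‖w‖ := by
    refine (R.flip.le_opNorm w).trans ?_
    rw [ContinuousLinearMap.opNorm_flip]
    exact mul_le_of_le_one_left (norm_nonneg _) hR
  refine hA.val_le_of_weakStarLim (Q := fun s => Z ⧸ finAnnihilator R.flip s) U
    (fun s w => quotientEval R.flip s w) (fun s w => (norm_quotientEval_le s w).trans (hj w))
    (fun v w => ?_) (fun c w => ?_)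
    (fun s => (finAnnihilator R.flip s).mkQL ∘L T) _ (fun x w => ?_) hM.lt_top
    (fun s => A.val_mkQL_comp_le_maxHull T (finAnnihilator R.flip s))
  -- `quotientEval` is zero off `s`, so additivity is only claimed once `s` contains all three
  -- vectors.
  · filter_upwards [hU v, hU w, hU (v + w)] with s hv hw hvw
    refine quotient_dual_ext fun z => ?_
    simp only [add_apply]
    rw [quotientEval_mkQ hvw, quotientEval_mkQ hv, quotientEval_mkQ hw]
    simp
  · filter_upwards [hU w, hU (c • w)] with s hw hcw
    refine quotient_dual_ext fun z => ?_
    simp only [smul_apply]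
    rw [quotientEval_mkQ hcw, quotientEval_mkQ hw]
    simp
  · filter_upwards [hU w] with s hs
    exact quotientEval_mkQ (j := R.flip) hs (T x)

theorem BanachIdeal.Ultrastable.val_le_maxHull {A : BanachIdeal.{u} 𝕜} (hA : A.Ultrastable)
    [NormedAddCommGroup W] [NormedSpace 𝕜 W] {E : Type u} [NormedAddCommGroup E] [NormedSpace 𝕜 E] [CompleteSpace E]
    [FiniteDimensional 𝕜 E] (T : E →L[𝕜] StrongDual 𝕜 W) :
    A.val T ≤ A.toOperatorGauge.maxHull.val (X := E) (Y := StrongDual 𝕜 W) T :=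
  hA.val_comp_le_maxHull (Z := StrongDual 𝕜 W) T (.id 𝕜 _) ContinuousLinearMap.norm_id_le

end Annihilator

/-! ### The classical principle of local reflexivity. -/

section LocalReflexivity

variable {𝕜 : Type} [RCLike 𝕜]

/-- A finite `δ`-net of the unit ball works, and it serves all targets `Y` and operators `R` at
once. -/
theorem exists_finite_norming_set (F : Type*) [NormedAddCommGroup F] [NormedSpace 𝕜 F]
    [FiniteDimensional 𝕜 F] {δ : ℝ} (hδ : 0 < δ) :
    ∃ t : Finset F, (∀ f ∈ t, ‖f‖ ≤ 1) ∧
      ∀ (Y : Type u) [NormedAddCommGroup Y] [NormedSpace 𝕜 Y] (R : F →L[𝕜] Y) (C : ℝ), 0 ≤ C →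
        (∀ f ∈ t, ‖R f‖ ≤ C) → (1 - δ) * ‖R‖ ≤ C := by
  have : ProperSpace F := FiniteDimensional.proper 𝕜 F
  obtain ⟨t, ht, hfin, hcov⟩ := (isCompact_closedBall (0 : F) 1).finite_cover_balls hδ
  lift t to Finset F using hfin
  refine ⟨t, fun f hf => by simpa using ht hf, fun Y _ _ R C hC hR => ?_⟩
  suffices ‖R‖ ≤ ‖R‖ * δ + C by linarith
  refine R.opNorm_le_bound (by positivity) fun x => ?_
  rcases eq_or_ne x 0 with rfl | hx
  · simp
  have hx' : ‖x‖ ≠ 0 := norm_ne_zero_iff.2 hx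
  set v : F := ((‖x‖ : 𝕜)⁻¹) • x with hv
  have hvn : ‖v‖ = 1 := by simp [hv, norm_smul, hx']
  obtain ⟨f, hf, hvf⟩ := Set.mem_iUnion₂.1 (hcov (show v ∈ _ by simp [hvn]))
  have hxv : x = (‖x‖ : 𝕜) • v := by
    rw [hv, smul_inv_smul₀]; exact_mod_cast hx'
  have h1 : ‖R v‖ ≤ ‖R‖ * δ + C := by
    calc ‖R v‖ = ‖R (v - f) + R f‖ := by rw [← map_add, sub_add_cancel]
      _ ≤ ‖R (v - f)‖ + ‖R f‖ := norm_add_le _ _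
      _ ≤ ‖R‖ * δ + C := by
        gcongr
        · refine (R.le_opNorm _).trans ?_
          gcongr
          rw [mem_ball_iff_norm] at hvf
          exact hvf.le
        · exact hR f hf
  calc ‖R x‖ = ‖x‖ * ‖R v‖ := by
        conv_lhs => rw [hxv]
        simp [norm_smul]
    _ ≤ ‖x‖ * (‖R‖ * δ + C) := by gcongr
    _ = _ := mul_comm _ _

/-- The dual of a finite sup-norm sum carries the sum norm: nearly norming vectors, rotated to give
real values, are assembled into one vector of the unit ball. -/
theorem sum_norm_comp_single_le {ι : Type*} [Fintype ι] [DecidableEq ι] {Y : Type*}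
    [NormedAddCommGroup Y] [NormedSpace 𝕜 Y] (g : StrongDual 𝕜 (ι → Y)) :
    ∑ i, ‖g ∘L ContinuousLinearMap.single 𝕜 (fun _ => Y) i‖ ≤ ‖g‖ := by
  refine le_of_forall_pos_le_add fun ε hε => ?_
  set η : ℝ := ε / (Fintype.card ι + 1) with hη
  have hη0 : 0 < η := by positivity
  have key i : ∃ y : Y, ‖y‖ ≤ 1 ∧ ∃ r : ℝ, g (Pi.single i y) = r ∧
      ‖g ∘L ContinuousLinearMap.single 𝕜 (fun _ => Y) i‖ - η ≤ r := by
    obtain ⟨x, hx, hgx⟩ := ContinuousLinearMap.exists_lt_apply_of_lt_opNorm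
      (g ∘L ContinuousLinearMap.single 𝕜 (fun _ => Y) i) (sub_lt_self _ hη0)
    obtain ⟨c, hc, hcx⟩ := RCLike.exists_norm_eq_mul_self (g (Pi.single i x))
    refine ⟨c • x, by rw [norm_smul, hc, one_mul]; exact hx.le, ‖g (Pi.single i x)‖, ?_, hgx.le⟩
    have h := map_smul (g ∘L ContinuousLinearMap.single 𝕜 (fun _ => Y) i) c x
    rw [hcx]
    exact h
  choose y hy r hr hle using key
  have hgy : g y = ((∑ i, r i : ℝ) : 𝕜) := by
    conv_lhs => rw [← Finset.univ_sum_single y, map_sum]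
    simp [hr]
  have h1 : ∑ i, r i ≤ ‖g‖ := by
    calc ∑ i, r i ≤ ‖((∑ i, r i : ℝ) : 𝕜)‖ := by rw [RCLike.norm_ofReal]; exact le_abs_self _
      _ = ‖g y‖ := by rw [hgy]
      _ ≤ ‖g‖ * ‖y‖ := g.le_opNorm y
      _ ≤ ‖g‖ := mul_le_of_le_one_right (norm_nonneg _)
        ((pi_norm_le_iff_of_nonneg zero_le_one).2 hy)
  have h2 := Finset.sum_le_sum fun i (_ : i ∈ Finset.univ) => hle i
  rw [Finset.sum_sub_distrib, Finset.sum_const, Finset.card_univ, nsmul_eq_mul] at h2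
  have h3 : (Fintype.card ι : ℝ) * η ≤ ε := by
    rw [hη, mul_div_assoc', div_le_iff₀ (by positivity)]
    nlinarith
  linarith

/-- Functionals on the operators from a finite-dimensional space are represented by nuclear
tensors, with almost equality of norms. -/
theorem exists_nuclear_representation {F : Type*} {Y : Type u} [NormedAddCommGroup F]
    [NormedSpace 𝕜 F] [FiniteDimensional 𝕜 F] [NormedAddCommGroup Y] [NormedSpace 𝕜 Y]
    (ψ : StrongDual 𝕜 (F →L[𝕜] Y)) {δ : ℝ} (hδ : 0 < δ) (hδ1 : δ < 1) :
    ∃ (t : Finset F) (y : t → StrongDual 𝕜 Y), (∀ f : t, ‖(f : F)‖ ≤ 1) ∧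
      (∀ R, ψ R = ∑ f : t, y f (R f)) ∧ (1 - δ) * ∑ f : t, ‖y f‖ ≤ ‖ψ‖ := by
  classical
  obtain ⟨t, ht, hnorm⟩ := exists_finite_norming_set.{u} (𝕜 := 𝕜) F hδ
  have hδ' : 0 < 1 - δ := sub_pos.2 hδ1
  -- Evaluation on the net embeds `L(F, Y)` into a sup-norm sum with lower bound `1 - δ`. A
  -- Hahn–Banach extension of `ψ` from the image has the required `y f` as its coordinates.
  let Φ : (F →L[𝕜] Y) →ₗ[𝕜] (t → Y) :=
    { toFun := fun R f => R f
      map_add' := fun _ _ => rfl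
      map_smul' := fun _ _ => rfl }
  have hΦ R : (1 - δ) * ‖R‖ ≤ ‖Φ R‖ :=
    hnorm Y R _ (norm_nonneg _) fun f hf => norm_le_pi_norm (Φ R) ⟨f, hf⟩
  have hinj : Function.Injective Φ := by
    refine (injective_iff_map_eq_zero Φ).2 fun R hR => ?_
    have := hΦ R
    rw [hR, norm_zero] at this
    exact norm_le_zero_iff.1 (nonpos_of_mul_nonpos_right this hδ')
  let e := LinearEquiv.ofInjective Φ hinj
  let f0 : StrongDual 𝕜 (LinearMap.range Φ) :=
    LinearMap.mkContinuous (ψ.toLinearMap ∘ₗ e.symm.toLinearMap) (‖ψ‖ / (1 - δ)) fun x => by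
      obtain ⟨R, rfl⟩ := e.surjective x
      have h1 : ‖ψ (e.symm (e R))‖ ≤ ‖ψ‖ * ‖R‖ := by
        rw [e.symm_apply_apply]; exact ψ.le_opNorm R
      refine h1.trans ?_
      rw [div_mul_eq_mul_div, le_div_iff₀ hδ', mul_assoc, mul_comm ‖R‖]
      gcongr
      exact hΦ R
  have hf0 : ‖f0‖ ≤ ‖ψ‖ / (1 - δ) := LinearMap.mkContinuous_norm_le _ (by positivity) _
  obtain ⟨g, hg, hgn⟩ := exists_extension_norm_eq _ f0
  refine ⟨t, fun f => g ∘L ContinuousLinearMap.single 𝕜 (fun _ => Y) f, fun f => ht f f.2,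
    fun R => ?_, ?_⟩
  · have h1 : g (Φ R) = ψ R := (hg (e R)).trans (congrArg ψ (e.symm_apply_apply R))
    rw [← h1, ← Finset.univ_sum_single (Φ R), map_sum]
    simp [Φ]
  · rw [mul_comm, ← le_div_iff₀ hδ']
    exact (sum_norm_comp_single_le g).trans (hgn.le.trans hf0)

/-- The distance from `x` to `N` is the norm of `x` in the quotient, and functionals on the quotient
are those annihilating `N`. -/
theorem exists_mem_norm_sub_lt_of_dual_le {X : Type*} [NormedAddCommGroup X] [NormedSpace 𝕜 X]
    (N : Submodule 𝕜 X) [IsClosed (N : Set X)] (x : X) {B C : ℝ}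
    (hB : ∀ ψ : StrongDual 𝕜 X, (∀ n ∈ N, ψ n = 0) → ‖ψ x‖ ≤ B * ‖ψ‖) (hB0 : 0 ≤ B) (hBC : B < C) :
    ∃ z : X, z - x ∈ N ∧ ‖z‖ < C := by
  obtain ⟨φ, hφ, hφx⟩ := exists_dual_vector'' 𝕜 (N.mkQ x)
  have h1 : ‖φ ∘L N.mkQL‖ ≤ 1 :=
    (ContinuousLinearMap.opNorm_comp_le _ _).trans
      (mul_le_one₀ hφ (norm_nonneg _) (norm_mkQL_le_one N))
  have h2 : ‖N.mkQ x‖ ≤ B := by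
    have h3 := hB (φ ∘L N.mkQL) fun n hn => by
      have : N.mkQ n = 0 := (Submodule.Quotient.mk_eq_zero N).2 hn
      change φ (N.mkQ n) = 0
      rw [this, map_zero]
    change ‖φ (N.mkQ x)‖ ≤ _ at h3
    rw [hφx, RCLike.norm_ofReal, abs_norm] at h3
    exact h3.trans (mul_le_of_le_one_right hB0 h1)
  obtain ⟨z, hz, hzn⟩ := Submodule.Quotient.norm_mk_lt (N.mkQ x) (sub_pos.2 hBC)
  exact ⟨z, (Submodule.Quotient.eq N).1 hz, by linarith⟩

section Separation

variable {Y G : Type*} [AddCommGroup Y] [Module 𝕜 Y] [AddCommGroup G] [Module 𝕜 G]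
  [FiniteDimensional 𝕜 G]

/-- The transpose `Y → G*` is surjective: as `G` is reflexive, a functional killing its range is
evaluation at some `g` with `γ g = 0`. -/
theorem exists_forall_apply_eq_of_injective {γ : G →ₗ[𝕜] Y →ₗ[𝕜] 𝕜} (hγ : Function.Injective γ)
    (φ : G →ₗ[𝕜] 𝕜) : ∃ y : Y, ∀ g, γ g y = φ g := by
  have hev : Function.Surjective γ.flip := by
    rw [← LinearMap.dualMap_injective_iff]
    refine (injective_iff_map_eq_zero _).2 fun Λ hΛ => ?_
    obtain ⟨g, rfl⟩ := (Module.evalEquiv 𝕜 G).surjective Λ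
    have : g = 0 := (injective_iff_map_eq_zero γ).1 hγ g <| by
      ext y
      exact LinearMap.congr_fun hΛ y
    simp [this]
  obtain ⟨y, hy⟩ := hev φ
  exact ⟨y, fun g => LinearMap.congr_fun hy g⟩

theorem exists_apply_eq_of_forall_eq_zero (γ : G →ₗ[𝕜] Y →ₗ[𝕜] 𝕜) (v : Y →ₗ[𝕜] 𝕜)
    (hv : ∀ y, (∀ g, γ g y = 0) → v y = 0) : ∃ g, γ g = v := by
  let b := Module.finBasis 𝕜 G
  have h := mem_span_of_iInf_ker_le_ker (L := fun i => γ (b i)) (K := v) fun y hy => by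
    refine hv y fun g => ?_
    have h1 : ∀ i, γ (b i) y = 0 := by simpa using hy
    rw [← b.sum_repr g]
    simp [-Module.Basis.sum_repr, h1]
  obtain ⟨c, hc⟩ := (Submodule.mem_span_range_iff_exists_fun 𝕜).1 h
  exact ⟨∑ i, c i • b i, by simpa using hc⟩

end Separation

section Lifting

variable {F G : Type*} {Y : Type u} [NormedAddCommGroup F] [NormedSpace 𝕜 F]
  [FiniteDimensional 𝕜 F] [NormedAddCommGroup Y] [NormedSpace 𝕜 Y]
  [AddCommGroup G] [Module 𝕜 G]

variable (𝕜 Y) in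
/-- The canonical embedding of a space into the algebraic dual of its dual. -/
def evalDual : Y →ₗ[𝕜] StrongDual 𝕜 Y →ₗ[𝕜] 𝕜 where
  toFun y :=
    { toFun := fun y' => y' y
      map_add' := fun _ _ => rfl
      map_smul' := fun _ _ => rfl }
  map_add' x y := by ext; simp
  map_smul' c x := by ext; simp

theorem evalDual_apply (y : Y) (y' : StrongDual 𝕜 Y) : evalDual 𝕜 Y y y' = y' y := rfl

theorem evalDual_injective : Function.Injective (evalDual 𝕜 Y) := fun _ _ h =>
  (SeparatingDual.eq_iff_forall_dual_eq (R := 𝕜)).2 fun y' => LinearMap.congr_fun h y'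

/-- The constraints of local reflexivity can be satisfied without control of the norm. -/
theorem exists_lift_of_bidual [FiniteDimensional 𝕜 G] (T : F →ₗ[𝕜] StrongDual 𝕜 Y →ₗ[𝕜] 𝕜)
    {γ : G →ₗ[𝕜] StrongDual 𝕜 Y} (hγ : Function.Injective γ) :
    ∃ R : F →L[𝕜] Y, (∀ f g, γ g (R f) = T f (γ g)) ∧
      ∀ f, T f ∈ LinearMap.range (evalDual 𝕜 Y) → evalDual 𝕜 Y (R f) = T f := by
  let F₀ : Submodule 𝕜 F := (LinearMap.range (evalDual 𝕜 Y)).comap T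
  obtain ⟨P, hP⟩ := F₀.subtype.exists_leftInverse_of_injective (Submodule.ker_subtype _)
  have hP' (f : F₀) : P f = f := LinearMap.congr_fun hP f
  let e := LinearEquiv.ofInjective (evalDual 𝕜 Y) evalDual_injective
  let T₀ : F₀ →ₗ[𝕜] LinearMap.range (evalDual 𝕜 Y) := (T ∘ₗ F₀.subtype).codRestrict _ fun f => f.2
  let L₀ : F₀ →ₗ[𝕜] Y := e.symm.toLinearMap ∘ₗ T₀
  have hL₀ (f : F₀) : evalDual 𝕜 Y (L₀ f) = T f :=
    congrArg Subtype.val (e.apply_symm_apply (T₀ f))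
  have hγ' : Function.Injective ((evalDual 𝕜 Y).flip ∘ₗ γ) := fun x y h => hγ <| by
    ext z
    exact LinearMap.congr_fun h z
  let b := Module.finBasis 𝕜 F
  have hy i : ∃ y : Y, ∀ g, γ g y = T (b i) (γ g) :=
    exists_forall_apply_eq_of_injective hγ' (T (b i) ∘ₗ γ)
  choose y hy using hy
  let L₁ : F →ₗ[𝕜] Y := b.constr 𝕜 y
  have hL₁ (f : F) (g : G) : γ g (L₁ f) = T f (γ g) := by
    have : (γ g).toLinearMap ∘ₗ L₁ = T.flip (γ g) := b.ext fun i => by simpa [L₁] using hy i g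
    exact LinearMap.congr_fun this f
  -- `L₁` meets the functional constraints and `L₀` lifts `T` on `F₀`. The correction makes `R`
  -- agree with `L₀` on `F₀`, and the functionals `γ g` do not see it, since there `L₀` and `L₁`
  -- take the same values.
  let R : F →ₗ[𝕜] Y := L₁ + (L₀ - L₁ ∘ₗ F₀.subtype) ∘ₗ P
  refine ⟨LinearMap.toContinuousLinearMap R, fun f g => ?_, fun f hf => ?_⟩
  · have h : γ g (L₀ (P f)) = T (P f : F) (γ g) := by
      rw [← hL₀ (P f), evalDual_apply]
    change γ g (L₁ f + (L₀ (P f) - L₁ (P f : F))) = _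
    rw [map_add, map_sub, hL₁, hL₁, h, sub_self, add_zero]
  · let f₀ : F₀ := ⟨f, hf⟩
    have hPf : P f = f₀ := hP' f₀
    change evalDual 𝕜 Y (L₁ f + (L₀ (P f) - L₁ (P f : F))) = _
    rw [hPf, ← hL₀ f₀]
    congr 1
    exact add_sub_cancel _ _

/-- The operators annihilating the subspace on which `T` is `Y`-valued and with range
annihilated by the functionals `γ g`. -/
def constraintKernel (T : F →ₗ[𝕜] StrongDual 𝕜 Y →ₗ[𝕜] 𝕜) (γ : G →ₗ[𝕜] StrongDual 𝕜 Y) :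
    Submodule 𝕜 (F →L[𝕜] Y) where
  carrier := {R | (∀ f g, γ g (R f) = 0) ∧
    ∀ f, T f ∈ LinearMap.range (evalDual 𝕜 Y) → R f = 0}
  zero_mem' := by simp
  add_mem' {R S} hR hS := ⟨fun f g => by simp [hR.1 f g, hS.1 f g],
    fun f hf => by simp [hR.2 f hf, hS.2 f hf]⟩
  smul_mem' c R hR := ⟨fun f g => by simp [hR.1 f g], fun f hf => by simp [hR.2 f hf]⟩

instance isClosed_constraintKernel (T : F →ₗ[𝕜] StrongDual 𝕜 Y →ₗ[𝕜] 𝕜)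
    (γ : G →ₗ[𝕜] StrongDual 𝕜 Y) : IsClosed (constraintKernel T γ : Set (F →L[𝕜] Y)) := by
  have hev (f : F) : Continuous fun R : F →L[𝕜] Y => R f :=
    (ContinuousLinearMap.apply 𝕜 Y f).continuous
  refine IsClosed.and (p₁ := fun R : F →L[𝕜] Y => ∀ f g, γ g (R f) = 0) ?_ ?_
  · simp only [Set.ofPred_forall]
    exact isClosed_iInter fun f => isClosed_iInter fun g =>
      isClosed_eq ((γ g).continuous.comp (hev f)) continuous_const
  · simp only [Set.ofPred_forall]
    exact isClosed_iInter fun f => isClosed_iInter fun _ => isClosed_eq (hev f) continuous_const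

/-- In a nuclear representation `ψ = ∑ f ⊗ y f`, replacing `R` by `T` does not change the value when
`ψ` kills the homogeneous constraints; the bound on `T` then applies termwise. -/
theorem norm_dual_apply_le_of_lift [FiniteDimensional 𝕜 G] {T : F →ₗ[𝕜] StrongDual 𝕜 Y →ₗ[𝕜] 𝕜}
    {M : ℝ} (hM : 0 ≤ M) (hT : ∀ f y', ‖T f y'‖ ≤ M * ‖f‖ * ‖y'‖)
    {γ : G →ₗ[𝕜] StrongDual 𝕜 Y} {R : F →L[𝕜] Y} (hR : ∀ f g, γ g (R f) = T f (γ g))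
    (hRj : ∀ f, T f ∈ LinearMap.range (evalDual 𝕜 Y) → evalDual 𝕜 Y (R f) = T f)
    (ψ : StrongDual 𝕜 (F →L[𝕜] Y)) (hψ : ∀ S ∈ constraintKernel T γ, ψ S = 0) :
    ‖ψ R‖ ≤ M * ‖ψ‖ := by
  have key {δ : ℝ} (hδ : 0 < δ) (hδ1 : δ < 1) : (1 - δ) * ‖ψ R‖ ≤ M * ‖ψ‖ := by
    obtain ⟨t, y, ht, hy, hn⟩ := exists_nuclear_representation ψ hδ hδ1
    have hψR : ψ R = ∑ f : t, T f (y f) := by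
      let F₀ : Submodule 𝕜 F := (LinearMap.range (evalDual 𝕜 Y)).comap T
      obtain ⟨P, hP⟩ := F₀.subtype.exists_leftInverse_of_injective (Submodule.ker_subtype _)
      have hP' (f : F₀) : P f = f := LinearMap.congr_fun hP f
      let b := Module.finBasis 𝕜 F
      -- These functionals vanish on `F₀`. The defect `D` also vanishes there, hence is determined
      -- by the `c i` and the vectors `D (b i)`.
      let c i : F →L[𝕜] 𝕜 := LinearMap.toContinuousLinearMap
        (b.coord i ∘ₗ (LinearMap.id - F₀.subtype ∘ₗ P))
      let v i : StrongDual 𝕜 Y := ∑ f : t, c i f • y f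
      let D : F →ₗ[𝕜] StrongDual 𝕜 Y →ₗ[𝕜] 𝕜 := evalDual 𝕜 Y ∘ₗ R.toLinearMap - T
      have hDc (f : F) : D f = ∑ i, c i f • D (b i) := by
        have h0 : D (P f : F) = 0 := sub_eq_zero.2 (hRj _ (P f).2)
        have h1 := congrArg D (b.sum_repr (f - P f))
        rw [map_sub D, h0, sub_zero] at h1
        rw [← h1, map_sum]
        simp [c]
      -- Testing `ψ` on `c i ⊗ z`, with `z` killed by every `γ g`, gives `v i z = 0`. Hence `v i`
      -- lies in the range of `γ`, where `D (b i)` vanishes.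
      have hv i : D (b i) (v i) = 0 := by
        obtain ⟨g, hg⟩ := exists_apply_eq_of_forall_eq_zero ((evalDual 𝕜 Y).flip ∘ₗ γ)
          (v i).toLinearMap fun z hz => by
            have hmem : (c i).smulRight z ∈ constraintKernel T γ := by
              refine ⟨fun f g => ?_, fun f hf => ?_⟩
              · have : γ g z = 0 := hz g
                simp [this]
              · have : P f = (⟨f, hf⟩ : F₀) := hP' ⟨f, hf⟩
                simp [c, this]
            have := hψ _ hmem
            rw [hy] at this
            simpa [v] using this
        have hg' : γ g = v i := by
          ext z
          exact LinearMap.congr_fun hg z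
        rw [← hg']
        exact sub_eq_zero.2 (hR (b i) g)
      have hsum : ∑ f : t, D f (y f) = 0 := by
        calc ∑ f : t, D f (y f) = ∑ f : t, ∑ i, c i f • D (b i) (y f) := by
              refine Finset.sum_congr rfl fun f _ => ?_
              rw [hDc f]
              simp
          _ = ∑ i, D (b i) (v i) := by
              rw [Finset.sum_comm]
              simp [v]
          _ = 0 := by simp [hv]
      rw [hy, ← sub_eq_zero, ← Finset.sum_sub_distrib]
      exact hsum
    have h1 : ‖ψ R‖ ≤ M * ∑ f : t, ‖y f‖ := by
      rw [hψR, Finset.mul_sum]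
      refine norm_sum_le_of_le _ fun f _ => ?_
      refine (hT f (y f)).trans ?_
      gcongr
      exact mul_le_of_le_one_right hM (ht f)
    calc (1 - δ) * ‖ψ R‖ ≤ (1 - δ) * (M * ∑ f : t, ‖y f‖) := by
          have : 0 ≤ 1 - δ := by linarith
          gcongr
      _ = M * ((1 - δ) * ∑ f : t, ‖y f‖) := by ring
      _ ≤ M * ‖ψ‖ := by gcongr
  by_contra! h
  set a := ‖ψ R‖
  set B := M * ‖ψ‖
  have hB : 0 ≤ B := by positivity
  have ha : 0 < a := hB.trans_lt h
  -- This `δ` turns `(1 - δ) a` into the midpoint of `a` and `B`, which exceeds `B`.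
  have h1 := key (δ := (a - B) / (2 * a)) (div_pos (sub_pos.2 h) (by positivity))
    ((div_lt_one (by positivity)).2 (by linarith))
  have h2 : (1 - (a - B) / (2 * a)) * a = (a + B) / 2 := by field_simp; ring
  linarith

/-- The principle of local reflexivity. -/
theorem exists_lift_of_bidual_norm_lt [FiniteDimensional 𝕜 G]
    {T : F →ₗ[𝕜] StrongDual 𝕜 Y →ₗ[𝕜] 𝕜} {M C : ℝ} (hM : 0 ≤ M)
    (hT : ∀ f y', ‖T f y'‖ ≤ M * ‖f‖ * ‖y'‖) (hC : M < C)
    {γ : G →ₗ[𝕜] StrongDual 𝕜 Y} (hγ : Function.Injective γ) :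
    ∃ R : F →L[𝕜] Y, ‖R‖ < C ∧ (∀ f g, γ g (R f) = T f (γ g)) ∧
      ∀ f, T f ∈ LinearMap.range (evalDual 𝕜 Y) → evalDual 𝕜 Y (R f) = T f := by
  obtain ⟨R₀, h1, h2⟩ := exists_lift_of_bidual T hγ
  obtain ⟨R, hR, hRC⟩ := exists_mem_norm_sub_lt_of_dual_le (constraintKernel T γ) R₀
    (norm_dual_apply_le_of_lift hM hT h1 h2) hM hC
  refine ⟨R, hRC, fun f g => ?_, fun f hf => ?_⟩
  · have := hR.1 f g
    rwa [sub_apply, map_sub, h1 f g, sub_eq_zero] at this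
  · have := hR.2 f hf
    rw [sub_apply, sub_eq_zero] at this
    rw [this, h2 f hf]

end Lifting

end LocalReflexivity

/-! ### Combining accessibility with classical local reflexivity. -/

theorem BanachIdeal.RightAccessible.localReflexivity {𝕜 : Type} [RCLike 𝕜]
    {A : BanachIdeal.{u} 𝕜} (hA : A.RightAccessible)
    (hmax : ∀ (E Y : Type u) [NormedAddCommGroup E] [NormedSpace 𝕜 E] [CompleteSpace E]
      [FiniteDimensional 𝕜 E] [NormedAddCommGroup Y] [NormedSpace 𝕜 Y]
      (T : E →L[𝕜] StrongDual 𝕜 Y),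
      A.val T ≤ A.toOperatorGauge.maxHull.val (X := E) (Y := StrongDual 𝕜 Y) T) :
    A.LocalReflexivity := by
  intro E Y _ _ _ _ _ _ _ G _ T ε hε
  -- Two factors `1 + η` are lost, one to accessibility and one to lifting; `η ≤ 1` gives `(1 + η)²
  -- ≤ 1 + 3η ≤ 1 + ε`.
  set η : ℝ := min 1 (ε / 3)
  have hη : 0 < η := by positivity
  have hη' : (1 + η) * (1 + η) ≤ 1 + ε := by
    have h1 : η ≤ 1 := min_le_left _ _
    have h2 : η ≤ ε / 3 := min_le_right _ _
    nlinarith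
  obtain ⟨F, hF, S, rfl, hAS⟩ := hA E (StrongDual 𝕜 (StrongDual 𝕜 Y)) T η hη
  let ι : F →ₗ[𝕜] StrongDual 𝕜 Y →ₗ[𝕜] 𝕜 :=
    { toFun := fun f => (f : StrongDual 𝕜 (StrongDual 𝕜 Y)).toLinearMap
      map_add' := fun _ _ => rfl
      map_smul' := fun _ _ => rfl }
  have hι (f : F) (y' : StrongDual 𝕜 Y) : ‖ι f y'‖ ≤ 1 * ‖f‖ * ‖y'‖ := by
    rw [one_mul]
    exact (f : StrongDual 𝕜 (StrongDual 𝕜 Y)).le_opNorm y'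
  obtain ⟨R, hRn, hRG, hRj⟩ := exists_lift_of_bidual_norm_lt (F := F) (T := ι) zero_le_one hι
    (lt_add_of_pos_right 1 hη) (G := G) (γ := G.subtype) G.injective_subtype
  refine ⟨R ∘L S, ?_, fun x y' hy' => hRG (S x) ⟨y', hy'⟩, fun x hx => ?_⟩
  swap
  · obtain ⟨y, hy⟩ := hx
    have := hRj (S x) ⟨y, by ext y'; exact congrArg (fun φ => φ y') hy⟩
    ext y'
    exact LinearMap.congr_fun this y'
  have hRe : ‖R‖ₑ ≤ ENNReal.ofReal (1 + η) := by
    rw [← ofReal_norm]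
    exact ENNReal.ofReal_le_ofReal hRn.le
  calc A.val (R ∘L S) ≤ ‖R‖ₑ * A.val S := A.val_comp_left_le R S
    _ ≤ ENNReal.ofReal (1 + η) * (ENNReal.ofReal (1 + η) *
        A.toOperatorGauge.adjoint.adjoint.val (X := E) (Y := StrongDual 𝕜 (StrongDual 𝕜 Y))
          (F.subtypeL ∘L S)) := by
      gcongr
      refine hAS.trans ?_
      gcongr
      exact (hmax _ _ _).trans (A.maxHull_le_adjoint_adjoint _)
    _ ≤ _ := by
      rw [← mul_assoc, ← ENNReal.ofReal_mul (by positivity)]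
      gcongr

end OpIdeal

theorem theorem3p2 (𝕜 : Type) [RCLike 𝕜] :
    (∀ A : OpIdeal.BanachIdeal.{u} 𝕜,
      A.RightAccessible → A.Ultrastable → A.LocalReflexivity) ∧
    (∀ A : OpIdeal.BanachIdeal.{u} 𝕜,
      A.RightAccessible → A.IsMaximal → A.LocalReflexivity) := by
  refine ⟨fun A hA hU => hA.localReflexivity ?_, fun A hA hM => hA.localReflexivity ?_⟩
  · intro E Y _ _ _ _ _ _ T
    exact hU.val_le_maxHull T
  · intro E Y _ _ _ _ _ _ T
    exact (hM E (StrongDual 𝕜 Y) T).le
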